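/- Let $d\ge 2$ be an integer, $\nu>0$ and $\lambda=(d-1)/2$. Let $G_n^{\lambda}$, $n\ge 0$, be the Gegenbauer polynomials, i.e. $(1-2rt+t^2)^{-\lambda}=\sum_{n\ge0}G_n^\lambda(r)t^n$ for $-1\le r\le 1$ and $|t|<1$. A sequence $(b_n)_{n\ge0}$ is called a Schoenberg sequence, on the sphere $\mathbb S^d$, of a function $K:[0,\pi]\to\mathbb R$ if $b_n\ge 0$ for all $n$, $\sum_{n\ge0} b_n G_n^\lambda(1)<\infty$, and $$K(\vartheta)=\sum_{n=0}^\infty b_n\,G_n^\lambda(\cos\vartheta)\qquad\text{for all } 0\le\vartheta\le\pi .$$ Then the exponential covariance $K(\vartheta)=\exp(-\nu\vartheta)$, $0\le\vartheta\le\pi$, has exactly one Schoenberg sequence $(b_{n,d})_{n\ge0}$ on $\mathbb S^d$, namely $$b_{n,d}=C(\nu,n)\,(\lambda+n)\,\Gamma(\lambda)\,\Gamma(\lambda+1)\,\frac{\left|\Gamma\!\left(\frac{n+i\nu}{2}\right)\right|^2}{\left|\Gamma\!\left(\lambda+1+\frac{n+i\nu}{2}\right)\right|^2},\qquad n\ge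 0,$$ where $$C(\nu,n)=\begin{cases}\dfrac{\nu\,e^{-\pi\nu/2}\sinh(\pi\nu/2)}{2\pi}&\text{if } n \text{ is even},\\[2ex]\dfrac{\nu\,e^{-\pi\nu/2}\cosh(\pi\nu/2)}{2\pi}&\text{if } n \text{ is odd}.\end{cases}$$ These numbers are also given by the inversion formula $$b_{n,d}=\frac{\displaystyle\int_0^\pi G_n^\lambda(\cos\vartheta)\,(\sin\vartheta)^{d-1}e^{-\nu\vartheta}\,d\vartheta}{\displaystyle\int_0^\pi \bigl[G_n^\lambda(\cos\vartheta)\bigr]^2(\sin\vartheta)^{d-1}\,d\vartheta},\qquad n\ge0 .$$ -/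

import Mathlib

noncomputable section

/-- The Gegenbauer polynomial of parameter `lam` and degree `n`, as a function of `r`,
through the classical three-term recurrence
`n G_n = 2 (n + lam - 1) r G_{n-1} - (n + 2 lam - 2) G_{n-2}`. -/
def gegenbauer (lam : ℝ) : ℕ → ℝ → ℝ
  | 0, _ => 1
  | 1, r => 2 * lam * r
  | n + 2, r =>
      2 * ((n : ℝ) + 1 + lam) / ((n : ℝ) + 2) * r * gegenbauer lam (n + 1) r
        - ((n : ℝ) + 2 * lam) / ((n : ℝ) + 2) * gegenbauer lam n r

/-- `b` is a Schoenberg sequence of the function `K` on `[0, π]` for the sphere of dimension `d`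
(`d ≥ 2`): the coefficients are nonnegative, `∑ b_n G_n(1)` converges, and `K` has the expansion
`K θ = ∑ b_n G_n(cos θ)` on all of `[0, π]`, with `G_n` of parameter `(d - 1) / 2`. -/
def IsSchoenbergSequence (d : ℕ) (K : ℝ → ℝ) (b : ℕ → ℝ) : Prop :=
  (∀ n, 0 ≤ b n) ∧
  Summable (fun n => b n * gegenbauer (((d : ℝ) - 1) / 2) n 1) ∧
  ∀ θ ∈ Set.Icc (0 : ℝ) Real.pi,
    HasSum (fun n => b n * gegenbauer (((d : ℝ) - 1) / 2) n (Real.cos θ)) (K θ)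

/-- The squared norm of the Gegenbauer polynomial of parameter `(d - 1) / 2` and degree `n`. -/
def gegenbauerNormSq (d n : ℕ) : ℝ :=
  ∫ θ in (0 : ℝ)..Real.pi,
    gegenbauer (((d : ℝ) - 1) / 2) n (Real.cos θ) ^ 2 * Real.sin θ ^ (d - 1)

/-- The `n`-th coefficient of `K` given by the Fourier–Gegenbauer inversion formula. -/
def schoenbergCoeff (d : ℕ) (K : ℝ → ℝ) (n : ℕ) : ℝ :=
  1 / gegenbauerNormSq d n *
    ∫ θ in (0 : ℝ)..Real.pi,
      gegenbauer (((d : ℝ) - 1) / 2) n (Real.cos θ) * Real.sin θ ^ (d - 1) * K θ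

/-- The constant `C(ν, n)`, which depends on `n` only through its parity. -/
def expCovConst (ν : ℝ) (n : ℕ) : ℝ :=
  if Even n then
    ν * Real.exp (-(Real.pi * ν / 2)) * Real.sinh (Real.pi * ν / 2) / (2 * Real.pi)
  else
    ν * Real.exp (-(Real.pi * ν / 2)) * Real.cosh (Real.pi * ν / 2) / (2 * Real.pi)

end

/-! Write k = d - 1 = 2λ, A_n = ∫ G_n(cos θ) sin^k θ e^{-νθ} and h_n = ∫ G_n(cos θ)² sin^k θ over
[0, π]. Everything rests on A_n = B_n h_n (`expWeightInt_gegenbauerPoly`).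

Two integrations by parts and the Gegenbauer equation tie A_{n+2} to A_n
(`expWeightInt_gegenbauerPoly_add_two`). Orthogonality gives h_{n+1} / h_n, and Γ(z+1) = zΓ(z) gives
B_{n+2} / B_n; the three agree. The cases n = 0, 1 reduce to ∫ sin^k θ e^{-νθ}, evaluated by a
two-step recurrence in k. Euler's reflection formula at iν/2 and (1+iν)/2 produces the sinh and
cosh, hence the dependence on parity.

Since |G_n| ≤ G_n(1) on [-1, 1], a Schoenberg series may be integrated term by term, so its
coefficients must be A_n / h_n: this is uniqueness. Conversely ∑ B_n G_n(1) converges, so ∑ B_n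
G_n(cos θ) is continuous with the same moments as e^{-νθ}, and completeness of the G_n identifies
the two. -/

open Polynomial

/-! ### Algebraic identities for Gegenbauer polynomials -/

/-- The Gegenbauer polynomial as an element of `ℝ[X]`. -/
noncomputable def gegenbauerPoly (lam : ℝ) : ℕ → ℝ[X]
  | 0 => 1
  | 1 => C (2 * lam) * X
  | n + 2 =>
      C (2 * ((n : ℝ) + 1 + lam) / ((n : ℝ) + 2)) * X * gegenbauerPoly lam (n + 1)
        - C (((n : ℝ) + 2 * lam) / ((n : ℝ) + 2)) * gegenbauerPoly lam n

theorem eval_gegenbauerPoly (lam : ℝ) (n : ℕ) (r : ℝ) :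
    (gegenbauerPoly lam n).eval r = gegenbauer lam n r := by
  induction n using Nat.twoStepInduction with
  | zero => simp [gegenbauerPoly, gegenbauer]
  | one => simp [gegenbauerPoly, gegenbauer]
  | more n h0 h1 => simp [gegenbauerPoly, gegenbauer, h0, h1]

theorem gegenbauerPoly_recurrence (lam : ℝ) (n : ℕ) :
    C ((n : ℝ) + 2) * gegenbauerPoly lam (n + 2) =
      C (2 * ((n : ℝ) + 1 + lam)) * (X * gegenbauerPoly lam (n + 1))
        - C ((n : ℝ) + 2 * lam) * gegenbauerPoly lam n := by
  have h : (n : ℝ) + 2 ≠ 0 := by positivity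
  rw [gegenbauerPoly, mul_sub, ← mul_assoc, ← mul_assoc, ← mul_assoc, ← C_mul, ← C_mul,
    mul_div_cancel₀ _ h, mul_div_cancel₀ _ h]
  ring

/-- Differentiating the three-term recurrence and multiplying by 1 - X² makes the induction close.
-/
theorem one_sub_sq_mul_derivative_gegenbauerPoly (lam : ℝ) (n : ℕ) :
    (1 - X ^ 2) * derivative (gegenbauerPoly lam n) =
      C ((n : ℝ) + 2 * lam) * (X * gegenbauerPoly lam n)
        - C ((n : ℝ) + 1) * gegenbauerPoly lam (n + 1) := by
  induction n using Nat.twoStepInduction with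
  | zero => simp [gegenbauerPoly]
  | one =>
    have h := gegenbauerPoly_recurrence lam 0
    simp [gegenbauerPoly] at h ⊢
    simp only [one_add_one_eq_two, show (C (2 : ℝ)) = (2 : ℝ[X]) from rfl] at h ⊢
    rw [h]
    ring
  | more n h0 h1 =>
    have hc : (C ((n : ℝ) + 2) : ℝ[X]) ≠ 0 := by
      rw [Ne, C_eq_zero]; positivity
    apply mul_left_cancel₀ hc
    have r0 := gegenbauerPoly_recurrence lam n
    have r1 := gegenbauerPoly_recurrence lam (n + 1)
    have hd := congrArg derivative r0
    simp only [derivative_mul, derivative_C, derivative_X, derivative_sub] at hd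
    push_cast at *
    simp only [map_add, map_mul, C_1, show (C (2 : ℝ)) = (2 : ℝ[X]) from rfl] at *
    simp only [add_assoc, Nat.reduceAdd] at *
    generalize (C (n : ℝ) : ℝ[X]) = N at *
    generalize (C lam : ℝ[X]) = l at *
    linear_combination (1 - X ^ 2) * hd + 2 * (N + 1 + l) * X * h1 - (N + 2 * l) * h0
      + (N + 2) * r1 - (N + 2 * l) * X * r0

theorem derivative_gegenbauerPoly_succ (lam : ℝ) (n : ℕ) :
    derivative (gegenbauerPoly lam (n + 1)) =
      X * derivative (gegenbauerPoly lam n) + C ((n : ℝ) + 2 * lam) * gegenbauerPoly lam n := by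
  have hx : (1 - X ^ 2 : ℝ[X]) ≠ 0 := by
    intro h
    have := congrArg (eval 0) h
    simp at this
  apply mul_left_cancel₀ hx
  have h0 := one_sub_sq_mul_derivative_gegenbauerPoly lam n
  have h1 := one_sub_sq_mul_derivative_gegenbauerPoly lam (n + 1)
  have r0 := gegenbauerPoly_recurrence lam n
  push_cast at *
  simp only [map_add, map_mul, C_1, show (C (2 : ℝ)) = (2 : ℝ[X]) from rfl] at *
  simp only [add_assoc, Nat.reduceAdd] at *
  linear_combination h1 - X * h0 - r0

/-- The Gegenbauer differential equation. -/
theorem gegenbauerPoly_ode (lam : ℝ) (n : ℕ) :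
    (1 - X ^ 2) * derivative (derivative (gegenbauerPoly lam n)) =
      C (2 * lam + 1) * (X * derivative (gegenbauerPoly lam n))
        - C ((n : ℝ) * (n + 2 * lam)) * gegenbauerPoly lam n := by
  have h := congrArg derivative (one_sub_sq_mul_derivative_gegenbauerPoly lam n)
  have h1 := derivative_gegenbauerPoly_succ lam n
  simp only [derivative_mul, derivative_C, derivative_X, derivative_sub, derivative_one,
    derivative_X_pow] at h
  rw [h1] at h
  simp only [map_add, map_mul, C_1, show (C (2 : ℝ)) = (2 : ℝ[X]) from rfl] at *
  push_cast at h
  simp only [show (C (2 : ℝ)) = (2 : ℝ[X]) from rfl] at *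
  linear_combination h

/-- Companion of the three-term recurrence: both (1 - X²) G_{n+1}' and X G_{n+1} are combinations of
G_n and G_{n+2}, which is what turns an identity about G_{n+1} into a two-step recurrence. -/
theorem gegenbauerPoly_recurrence' (lam : ℝ) (n : ℕ) :
    C (2 * ((n : ℝ) + 1 + lam)) * ((1 - X ^ 2) * derivative (gegenbauerPoly lam (n + 1))) =
      C (((n : ℝ) + 2 * lam) * (n + 2 * lam + 1)) * gegenbauerPoly lam n
        - C (((n : ℝ) + 1) * (n + 2)) * gegenbauerPoly lam (n + 2) := by
  have h1 := one_sub_sq_mul_derivative_gegenbauerPoly lam (n + 1)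
  have r0 := gegenbauerPoly_recurrence lam n
  push_cast at *
  simp only [map_add, map_mul, C_1, show (C (2 : ℝ)) = (2 : ℝ[X]) from rfl] at *
  simp only [add_assoc, Nat.reduceAdd] at *
  generalize (C (n : ℝ) : ℝ[X]) = N at *
  generalize (C lam : ℝ[X]) = l at *
  linear_combination 2 * (N + (1 + l)) * h1 - (N + 2 * l + 1) * r0

/-! ### Values at 1, parity and the bound on [-1, 1] -/

theorem gegenbauer_one_succ (lam : ℝ) (n : ℕ) :
    ((n : ℝ) + 1) * gegenbauer lam (n + 1) 1 = (n + 2 * lam) * gegenbauer lam n 1 := by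
  have h := congrArg (eval 1) (one_sub_sq_mul_derivative_gegenbauerPoly lam n)
  simp [eval_gegenbauerPoly] at h
  linarith

theorem gegenbauer_one_pos {lam : ℝ} (hl : 0 < lam) (n : ℕ) : 0 < gegenbauer lam n 1 := by
  induction n with
  | zero => simp [gegenbauer]
  | succ n ih =>
    have h := gegenbauer_one_succ lam n
    have : 0 < ((n : ℝ) + 1) * gegenbauer lam (n + 1) 1 := by rw [h]; positivity
    exact pos_of_mul_pos_right this (by positivity)

theorem gegenbauer_neg (lam : ℝ) (n : ℕ) (r : ℝ) :
    gegenbauer lam n (-r) = (-1) ^ n * gegenbauer lam n r := by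
  induction n using Nat.twoStepInduction with
  | zero => simp [gegenbauer]
  | one => simp [gegenbauer]
  | more n h0 h1 => simp only [gegenbauer, h0, h1]; ring

/-- `|G_n(r)| ≤ G_n(1)` on `[-1, 1]`, from the monotonicity of Sonin's function
`G_n ^ 2 + (1 - r ^ 2) G_n' ^ 2 / (n (n + 2 lam))`. -/
theorem abs_gegenbauer_le {lam : ℝ} (hl : 0 < lam) (n : ℕ) {r : ℝ} (hr : r ∈ Set.Icc (-1 : ℝ) 1) :
    |gegenbauer lam n r| ≤ gegenbauer lam n 1 := by
  rcases Nat.eq_zero_or_pos n with rfl | hn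
  · simp [gegenbauer]
  have hnR : (0 : ℝ) < n := by exact_mod_cast hn
  set G := gegenbauerPoly lam n with hG
  set c : ℝ := n * (n + 2 * lam) with hc
  have hcpos : 0 < c := by positivity
  set S : ℝ[X] := C c * G ^ 2 + (1 - X ^ 2) * derivative G ^ 2 with hS
  have hSd : derivative S = C (4 * lam) * (X * derivative G ^ 2) := by
    have ode := gegenbauerPoly_ode lam n
    rw [← hG, ← hc] at ode
    simp only [hS, derivative_add, derivative_mul, derivative_C, derivative_sub, derivative_one,
      pow_two, derivative_X]
    simp only [map_add, map_mul, C_1, show (C (2 : ℝ)) = (2 : ℝ[X]) from rfl,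
      show (C (4 : ℝ)) = (4 : ℝ[X]) from rfl] at *
    linear_combination 2 * derivative G * ode
  have key : ∀ s ∈ Set.Icc (0 : ℝ) 1, |gegenbauer lam n s| ≤ gegenbauer lam n 1 := by
    intro s hs
    have hmono : MonotoneOn (fun x => S.eval x) (Set.Icc 0 1) := by
      apply monotoneOn_of_deriv_nonneg (convex_Icc 0 1) S.continuous.continuousOn
        S.differentiable.differentiableOn
      intro x hx
      rw [interior_Icc] at hx
      rw [Polynomial.deriv, hSd]
      simp only [eval_mul, eval_C, eval_X, eval_pow]
      have := hx.1.le
      positivity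
    have h := hmono hs (Set.right_mem_Icc.2 zero_le_one) hs.2
    simp only [hS, eval_add, eval_mul, eval_C, eval_pow, eval_sub, eval_one, eval_X, hG,
      eval_gegenbauerPoly] at h
    have h2 : 0 ≤ (1 - s ^ 2) * eval s (derivative (gegenbauerPoly lam n)) ^ 2 :=
      mul_nonneg (by nlinarith [hs.1, hs.2]) (sq_nonneg _)
    apply abs_le_of_sq_le_sq _ (gegenbauer_one_pos hl n).le
    have h3 : c * gegenbauer lam n s ^ 2 ≤ c * gegenbauer lam n 1 ^ 2 := by linarith
    exact le_of_mul_le_mul_left h3 hcpos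
  -- Sonin's function increases only on [0, 1]; parity covers negative r.
  rcases le_total 0 r with h | h
  · exact key r ⟨h, hr.2⟩
  · have := key (-r) ⟨by linarith, by linarith [hr.1]⟩
    rw [gegenbauer_neg, abs_mul, abs_pow] at this
    simpa using this

/-! ### Exponentially weighted integrals -/

/-- Integration of a polynomial in `cos θ` against `sin θ ^ k * exp (-ν θ)` over `[0, π]`. -/
noncomputable def expWeightInt (ν : ℝ) (k : ℕ) : ℝ[X] →ₗ[ℝ] ℝ where
  toFun p := ∫ θ in (0 : ℝ)..Real.pi, p.eval (Real.cos θ) * Real.sin θ ^ k * Real.exp (-ν * θ)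
  map_add' p q := by
    rw [← intervalIntegral.integral_add (Continuous.intervalIntegrable (by fun_prop) _ _)
      (Continuous.intervalIntegrable (by fun_prop) _ _)]
    simp only [eval_add, add_mul]
  map_smul' c p := by
    rw [RingHom.id_apply, smul_eq_mul, ← intervalIntegral.integral_const_mul]
    simp only [eval_smul, smul_eq_mul, mul_assoc]

theorem expWeightInt_apply (ν : ℝ) (k : ℕ) (p : ℝ[X]) :
    expWeightInt ν k p =
      ∫ θ in (0 : ℝ)..Real.pi, p.eval (Real.cos θ) * Real.sin θ ^ k * Real.exp (-ν * θ) := rfl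

theorem expWeightInt_C_mul (ν : ℝ) (k : ℕ) (c : ℝ) (p : ℝ[X]) :
    expWeightInt ν k (C c * p) = c * expWeightInt ν k p := by
  rw [← smul_eq_C_mul, map_smul, smul_eq_mul]

theorem expWeightInt_add_two (ν : ℝ) (k : ℕ) (p : ℝ[X]) :
    expWeightInt ν (k + 2) p = expWeightInt ν k ((1 - X ^ 2) * p) := by
  simp only [expWeightInt_apply]
  congr 1
  ext θ
  simp only [eval_mul, eval_sub, eval_one, eval_pow, eval_X, ← Real.sin_sq]
  ring

/-- Integrate the derivative of sin^{k+1} θ q(cos θ) e^{-νθ}; the exponent k + 1 is positive, so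
both boundary terms vanish. -/
theorem expWeightInt_parts (ν : ℝ) (k : ℕ) (q : ℝ[X]) :
    expWeightInt ν k (C ((k : ℝ) + 1) * (X * q) - (1 - X ^ 2) * derivative q) =
      ν * expWeightInt ν (k + 1) q := by
  have hF : ∀ θ ∈ Set.uIcc 0 Real.pi, HasDerivAt
      (fun θ => Real.sin θ ^ (k + 1) * q.eval (Real.cos θ) * Real.exp (-ν * θ))
      ((C ((k : ℝ) + 1) * (X * q) - (1 - X ^ 2) * derivative q).eval (Real.cos θ)
          * Real.sin θ ^ k * Real.exp (-ν * θ)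
        - ν * (q.eval (Real.cos θ) * Real.sin θ ^ (k + 1) * Real.exp (-ν * θ))) θ := by
    intro θ _
    have h1 := (Real.hasDerivAt_sin θ).fun_pow (k + 1)
    have h2 := (q.hasDerivAt (Real.cos θ)).comp θ (Real.hasDerivAt_cos θ)
    have h3 := ((hasDerivAt_id θ).const_mul (-ν)).exp
    refine ((h1.mul h2).mul h3).congr_deriv ?_
    simp only [eval_mul, eval_sub, eval_one, eval_pow, eval_X, eval_C, ← Real.sin_sq,
      Function.comp, id, Nat.add_sub_cancel, Pi.mul_apply]
    push_cast
    ring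
  have hi := intervalIntegral.integral_eq_sub_of_hasDerivAt hF
    (Continuous.intervalIntegrable (by fun_prop) _ _)
  rw [intervalIntegral.integral_sub (Continuous.intervalIntegrable (by fun_prop) _ _)
      (Continuous.intervalIntegrable (by fun_prop) _ _),
    intervalIntegral.integral_const_mul] at hi
  simp only [Real.sin_pi, Real.sin_zero, ne_eq, Nat.add_eq_zero_iff, one_ne_zero, and_false,
    not_false_eq_true, zero_pow, zero_mul, sub_zero] at hi
  rw [expWeightInt_apply, expWeightInt_apply]
  linarith

theorem expWeightInt_X (ν : ℝ) (k : ℕ) :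
    ((k : ℝ) + 1) * expWeightInt ν k X = ν * expWeightInt ν (k + 1) 1 := by
  have h := expWeightInt_parts ν k 1
  simpa [← expWeightInt_C_mul] using h

theorem expWeightInt_one_add_two (ν : ℝ) (k : ℕ) :
    (((k : ℝ) + 2) ^ 2 + ν ^ 2) * expWeightInt ν (k + 2) 1 =
      (k + 2) * (k + 1) * expWeightInt ν k 1 := by
  have h := expWeightInt_parts ν k X
  have hX := expWeightInt_X ν (k + 1)
  have h2 := expWeightInt_add_two ν k 1
  -- Arranged around 1 - X² = sin², so that it raises the weight from k to k + 2.
  have e1 : C ((k : ℝ) + 1) * (X * X) - (1 - X ^ 2) * derivative X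
      = C ((k : ℝ) + 1) * 1 - C ((k : ℝ) + 2) * ((1 - X ^ 2) * 1) := by
    simp only [map_add, C_1, show (C (2 : ℝ)) = (2 : ℝ[X]) from rfl, derivative_X]
    ring
  rw [e1, map_sub, expWeightInt_C_mul, expWeightInt_C_mul, ← h2] at h
  push_cast at hX
  linear_combination (-((k : ℝ) + 2)) * h - ν * hX

theorem expWeightInt_one_pos (ν : ℝ) (k : ℕ) : 0 < expWeightInt ν k 1 := by
  rw [expWeightInt_apply]
  apply intervalIntegral.intervalIntegral_pos_of_pos_on
    (Continuous.intervalIntegrable (by fun_prop) _ _) _ Real.pi_pos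
  intro θ hθ
  have := Real.sin_pos_of_mem_Ioo hθ
  rw [eval_one]
  positivity

/-! ### Orthogonality, norms and the moment recurrence -/

section Orthogonality

variable {k : ℕ} {lam : ℝ} (hk : (k : ℝ) = 2 * lam)
include hk

/-- Weak Sturm–Liouville form of the differential equation, by parts with G_n' q. For q = G_m the
right side is symmetric in n and m, so distinct eigenvalues force orthogonality. -/
theorem expWeightInt_zero_ode (n : ℕ) (q : ℝ[X]) :
    ((n : ℝ) * (n + 2 * lam)) * expWeightInt 0 k (gegenbauerPoly lam n * q) =
      expWeightInt 0 k ((1 - X ^ 2) * (derivative (gegenbauerPoly lam n) * derivative q)) := by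
  have h := expWeightInt_parts 0 k (derivative (gegenbauerPoly lam n) * q)
  have ode := gegenbauerPoly_ode lam n
  rw [← hk] at ode
  have e : C ((k : ℝ) + 1) * (X * (derivative (gegenbauerPoly lam n) * q))
      - (1 - X ^ 2) * derivative (derivative (gegenbauerPoly lam n) * q)
      = C ((n : ℝ) * (n + 2 * lam)) * (gegenbauerPoly lam n * q)
        - (1 - X ^ 2) * (derivative (gegenbauerPoly lam n) * derivative q) := by
    rw [derivative_mul, ← hk]
    linear_combination (-q) * ode
  rw [e, map_sub, expWeightInt_C_mul, zero_mul] at h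
  linarith

theorem expWeightInt_zero_gegenbauerPoly_mul (hl : 0 < lam) {n m : ℕ} (hnm : n ≠ m) :
    expWeightInt 0 k (gegenbauerPoly lam n * gegenbauerPoly lam m) = 0 := by
  have h1 := expWeightInt_zero_ode hk n (gegenbauerPoly lam m)
  have h2 := expWeightInt_zero_ode hk m (gegenbauerPoly lam n)
  rw [mul_comm (gegenbauerPoly lam m), mul_comm (derivative (gegenbauerPoly lam m)), ← h1] at h2
  have h3 : ((m : ℝ) - n) * (m + n + 2 * lam) ≠ 0 := by
    apply mul_ne_zero
    · rw [sub_ne_zero]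
      exact_mod_cast hnm.symm
    · positivity
  apply (mul_eq_zero.1 _).resolve_left h3
  linear_combination h2

theorem expWeightInt_zero_gegenbauerPoly_sq_succ (hl : 0 < lam) (n : ℕ) :
    ((n : ℝ) + 1) * (n + 1 + lam) * expWeightInt 0 k (gegenbauerPoly lam (n + 1) ^ 2) =
      (n + lam) * (n + 2 * lam) * expWeightInt 0 k (gegenbauerPoly lam n ^ 2) := by
  have o : expWeightInt 0 k (gegenbauerPoly lam (n + 2) * gegenbauerPoly lam n) = 0 :=
    expWeightInt_zero_gegenbauerPoly_mul hk hl (by omega)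
  -- both `G_n` and `G_{n+1}` recurrences compute the integral of `X G_n G_{n+1}`
  have e1 := congrArg (fun p => expWeightInt 0 k (p * gegenbauerPoly lam n))
    (gegenbauerPoly_recurrence lam n)
  have e2 : ((n : ℝ) + 1) * expWeightInt 0 k (gegenbauerPoly lam (n + 1) ^ 2) =
      2 * (n + lam) * expWeightInt 0 k (X * gegenbauerPoly lam (n + 1) * gegenbauerPoly lam n) := by
    -- The recurrence producing G_{n+1} from G_n and G_{n-1} needs n ≥ 1; for n = 0 the explicit G_1
    -- is used.
    cases n with
    | zero =>
      simp only [gegenbauerPoly, ← expWeightInt_C_mul]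
      congr 1
      simp only [Nat.cast_zero, map_add, map_mul, C_1, map_zero,
        show (C (2 : ℝ)) = (2 : ℝ[X]) from rfl]
      ring
    | succ m =>
      have o' : expWeightInt 0 k (gegenbauerPoly lam m * gegenbauerPoly lam (m + 2)) = 0 :=
        expWeightInt_zero_gegenbauerPoly_mul hk hl (by omega)
      have := congrArg (fun p => expWeightInt 0 k (p * gegenbauerPoly lam (m + 2)))
        (gegenbauerPoly_recurrence lam m)
      simp only [sub_mul, map_sub, mul_assoc, expWeightInt_C_mul, o'] at this
      push_cast
      rw [show X * gegenbauerPoly lam (m + 2) * gegenbauerPoly lam (m + 1)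
        = X * (gegenbauerPoly lam (m + 1) * gegenbauerPoly lam (m + 2)) by ring, pow_two]
      linear_combination this
  simp only [sub_mul, map_sub, mul_assoc, expWeightInt_C_mul, o] at e1
  rw [mul_assoc X] at e2
  rw [pow_two (gegenbauerPoly lam n)]
  linear_combination ((n : ℝ) + 1 + lam) * e2 - ((n : ℝ) + lam) * e1

/-- Integrating by parts twice, starting from G_{n+1}', passes through the weights k + 2, k + 1 and
k. As sin^{k+2} = (1 - X²) sin^k, this relates the weight-k integrals of (1 - X²) G_{n+1}' and X
G_{n+1}, both of which involve only G_n and G_{n+2}. -/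
theorem expWeightInt_gegenbauerPoly_add_two (ν : ℝ) (n : ℕ) :
    ((n : ℝ) + 1) * (n + 2) * ((n + 2 * lam + 2) ^ 2 + ν ^ 2) *
        expWeightInt ν k (gegenbauerPoly lam (n + 2)) =
      (n + 2 * lam) * (n + 2 * lam + 1) * (n ^ 2 + ν ^ 2) *
        expWeightInt ν k (gegenbauerPoly lam n) := by
  set G := gegenbauerPoly lam (n + 1) with hG
  set H := derivative G with hH
  set c : ℝ := (n + 1) * (n + 1 + 2 * lam) with hc
  have ode : (1 - X ^ 2) * derivative H = C (2 * lam + 1) * (X * H) - C c * G := by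
    have := gegenbauerPoly_ode lam (n + 1)
    push_cast at this
    exact this
  -- The integrand left by the first integration by parts once the differential equation removes
  -- G''.
  set V := X * H + C c * G with hV
  have p1 : expWeightInt ν (k + 1) V = ν * expWeightInt ν (k + 2) H := by
    rw [← expWeightInt_parts]
    congr 1
    push_cast
    rw [hk, ode, hV]
    simp only [map_add, map_mul, C_1, show (C (2 : ℝ)) = (2 : ℝ[X]) from rfl]
    ring
  have p2 : expWeightInt ν k (C ((2 * lam + 2) * c) * (X * G) - C (1 + c) * ((1 - X ^ 2) * H)) =
      ν * expWeightInt ν (k + 1) V := by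
    rw [← expWeightInt_parts]
    congr 1
    rw [hk, hV]
    simp only [derivative_add, derivative_mul, derivative_X, derivative_C, ← hH]
    simp only [map_add, map_mul, C_1, show (C (2 : ℝ)) = (2 : ℝ[X]) from rfl] at ode ⊢
    linear_combination X * ode
  rw [p1, expWeightInt_add_two, map_sub, expWeightInt_C_mul, expWeightInt_C_mul] at p2
  have e1 := congrArg (expWeightInt ν k) (gegenbauerPoly_recurrence' lam n)
  have e2 := congrArg (expWeightInt ν k) (gegenbauerPoly_recurrence lam n)
  rw [map_sub, expWeightInt_C_mul, expWeightInt_C_mul, expWeightInt_C_mul] at e1 e2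
  rw [← hG, ← hH] at e1
  rw [← hG] at e2
  generalize expWeightInt ν k ((1 - X ^ 2) * H) = a at *
  generalize expWeightInt ν k (X * G) = b at *
  generalize expWeightInt ν k (gegenbauerPoly lam n) = x at *
  generalize expWeightInt ν k (gegenbauerPoly lam (n + 2)) = y at *
  rw [hc] at p2
  linear_combination (2 * ((n : ℝ) + 1 + lam)) * p2
    + (ν ^ 2 + 1 + (n + 1) * (n + 1 + 2 * lam)) * e1
    + (2 * lam + 2) * ((n + 1) * (n + 1 + 2 * lam)) * e2

end Orthogonality

/-! ### Gamma moduli and the integrals of sin^k θ e^{-νθ} -/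

/-- The squared modulus of the Gamma function at `s + i ν / 2`. -/
noncomputable def gammaNormSq (ν s : ℝ) : ℝ := ‖Complex.Gamma ((s : ℂ) + Complex.I * ν / 2)‖ ^ 2

theorem gammaNormSq_zero_right (s : ℝ) : gammaNormSq 0 s = Real.Gamma s ^ 2 := by
  simp [gammaNormSq, Complex.Gamma_ofReal]

theorem gammaNormSq_add_one {ν s : ℝ} (h : s ≠ 0 ∨ ν ≠ 0) :
    4 * gammaNormSq ν (s + 1) = (4 * s ^ 2 + ν ^ 2) * gammaNormSq ν s := by
  have hz : (s : ℂ) + Complex.I * ν / 2 ≠ 0 := by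
    intro h0
    have hr := congrArg Complex.re h0
    have hi := congrArg Complex.im h0
    simp at hr hi
    tauto
  have hn : ‖(s : ℂ) + Complex.I * ν / 2‖ ^ 2 = s ^ 2 + ν ^ 2 / 4 := by
    rw [← Complex.normSq_eq_norm_sq, Complex.normSq_apply]
    simp
    ring
  unfold gammaNormSq
  rw [show ((s + 1 : ℝ) : ℂ) + Complex.I * ν / 2 = (s + Complex.I * ν / 2) + 1 by push_cast; ring,
    Complex.Gamma_add_one _ hz, norm_mul, mul_pow, hn]
  ring

theorem gammaNormSq_pos {s : ℝ} (ν : ℝ) (hs : 0 < s) : 0 < gammaNormSq ν s := by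
  have : Complex.Gamma ((s : ℂ) + Complex.I * ν / 2) ≠ 0 :=
    Complex.Gamma_ne_zero_of_re_pos (by simpa using hs)
  unfold gammaNormSq
  positivity

/-- Reflection formula at the imaginary point z = iν/2, where 1 - z = 1 + conj z. -/
theorem gammaNormSq_zero {ν : ℝ} (hν : ν ≠ 0) :
    ν * Real.sinh (Real.pi * ν / 2) * gammaNormSq ν 0 = 2 * Real.pi := by
  have hs : Real.sinh (Real.pi * ν / 2) ≠ 0 := by
    rw [Ne, Real.sinh_eq_zero]
    have := Real.pi_pos.ne'
    positivity
  set z : ℂ := Complex.I * ν / 2 with hz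
  have hz0 : z ≠ 0 := by
    rw [hz]
    simpa using hν
  have h := Complex.Gamma_mul_Gamma_one_sub z
  rw [show 1 - z = -z + 1 by ring, Complex.Gamma_add_one _ (neg_ne_zero.2 hz0),
    show -z = (starRingEnd ℂ) z by simp [hz, map_ofNat]; ring, Complex.Gamma_conj,
    show (starRingEnd ℂ) z = -z by simp [hz, map_ofNat]; ring,
    show (Real.pi : ℂ) * z = ((Real.pi * ν / 2 : ℝ) : ℂ) * Complex.I by
      rw [hz]; push_cast; ring,
    Complex.sin_mul_I, ← Complex.ofReal_sinh] at h
  have h2 : -z * ((Complex.normSq (Complex.Gamma z) : ℝ) : ℂ)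
      = Real.pi / (Real.sinh (Real.pi * ν / 2) * Complex.I) := by
    rw [← h, ← Complex.mul_conj]
    ring
  have h3 : ((ν * Real.sinh (Real.pi * ν / 2) * Complex.normSq (Complex.Gamma z) : ℝ) : ℂ)
      = ((2 * Real.pi : ℝ) : ℂ) := by
    have hs' : ((Real.sinh (Real.pi * ν / 2) : ℝ) : ℂ) ≠ 0 := by exact_mod_cast hs
    rw [eq_div_iff (mul_ne_zero hs' Complex.I_ne_zero), hz] at h2
    push_cast at h2 ⊢
    have hI := Complex.I_mul_I
    linear_combination 2 * h2 + (ν : ℂ) * (Complex.normSq (Complex.Gamma (Complex.I * ν / 2)) : ℂ)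
      * Complex.sinh (Real.pi * ν / 2) * hI
  rw [gammaNormSq, ← Complex.normSq_eq_norm_sq]
  simpa using Complex.ofReal_injective h3

/-- Reflection formula on the critical line, where 1 - z = conj z. -/
theorem gammaNormSq_half (ν : ℝ) :
    Real.cosh (Real.pi * ν / 2) * gammaNormSq ν (1 / 2) = Real.pi := by
  have hs : Real.cosh (Real.pi * ν / 2) ≠ 0 := (Real.cosh_pos _).ne'
  set z : ℂ := ((1 / 2 : ℝ) : ℂ) + Complex.I * ν / 2 with hz
  have h := Complex.Gamma_mul_Gamma_one_sub z
  rw [show 1 - z = (starRingEnd ℂ) z by simp [hz, map_ofNat]; ring, Complex.Gamma_conj,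
    show (Real.pi : ℂ) * z = ((Real.pi * ν / 2 : ℝ) : ℂ) * Complex.I + Real.pi / 2 by
      rw [hz]; push_cast; ring,
    Complex.sin_add_pi_div_two, Complex.cos_mul_I, ← Complex.ofReal_cosh, Complex.mul_conj,
    eq_div_iff (by exact_mod_cast hs)] at h
  rw [gammaNormSq, ← Complex.normSq_eq_norm_sq]
  have h3 := Complex.ofReal_injective ((Complex.ofReal_mul _ _).trans h)
  rw [mul_comm]
  exact h3

theorem gammaNormSq_one (ν : ℝ) (hν : ν ≠ 0) :
    2 * Real.sinh (Real.pi * ν / 2) * gammaNormSq ν 1 = Real.pi * ν := by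
  have h := gammaNormSq_add_one (s := 0) (Or.inr hν)
  have h0 := gammaNormSq_zero hν
  rw [zero_add] at h
  linear_combination Real.sinh (Real.pi * ν / 2) / 2 * h + ν / 2 * h0

theorem expWeightInt_zero_one (ν : ℝ) :
    expWeightInt ν 0 1 * gammaNormSq ν 1 = Real.pi * Real.exp (-(Real.pi * ν / 2)) := by
  -- The main argument cancels ν sinh(πν/2). The value at ν = 0 is needed later as the
  -- normalization.
  rcases eq_or_ne ν 0 with rfl | hν
  · simp [expWeightInt_apply, gammaNormSq_zero_right]
  have h : ν * expWeightInt ν 0 1 = 1 - Real.exp (-ν * Real.pi) := by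
    have hF : ∀ θ ∈ Set.uIcc 0 Real.pi, HasDerivAt
        (fun θ => -Real.exp (-ν * θ)) (ν * Real.exp (-ν * θ)) θ := by
      intro θ _
      refine (((hasDerivAt_id θ).const_mul (-ν)).exp.neg).congr_deriv ?_
      simp
      ring
    have hi := intervalIntegral.integral_eq_sub_of_hasDerivAt hF
      (Continuous.intervalIntegrable (by fun_prop) _ _)
    rw [intervalIntegral.integral_const_mul] at hi
    simp only [expWeightInt_apply, eval_one, pow_zero, one_mul]
    rw [hi]
    simp
    ring
  have hs : Real.sinh (Real.pi * ν / 2) ≠ 0 := by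
    rw [Ne, Real.sinh_eq_zero]
    have := Real.pi_pos.ne'
    positivity
  have h1 := gammaNormSq_one ν hν
  have h2 : 1 - Real.exp (-ν * Real.pi)
      = 2 * Real.sinh (Real.pi * ν / 2) * Real.exp (-(Real.pi * ν / 2)) := by
    rw [Real.sinh_eq, show -ν * Real.pi = -(Real.pi * ν / 2) + -(Real.pi * ν / 2) by ring,
      Real.exp_add]
    have : Real.exp (Real.pi * ν / 2) * Real.exp (-(Real.pi * ν / 2)) = 1 := by
      rw [← Real.exp_add]; simp
    linear_combination -this
  rw [h2] at h
  apply mul_left_cancel₀ (mul_ne_zero hν hs)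
  linear_combination Real.sinh (Real.pi * ν / 2) * gammaNormSq ν 1 * h
    + Real.sinh (Real.pi * ν / 2) * Real.exp (-(Real.pi * ν / 2)) * h1

theorem expWeightInt_one_one (ν : ℝ) :
    expWeightInt ν 1 1 * 2 * gammaNormSq ν (3 / 2)
      = Real.pi * Real.exp (-(Real.pi * ν / 2)) := by
  have h : (1 + ν ^ 2) * expWeightInt ν 1 1 = 1 + Real.exp (-ν * Real.pi) := by
    have hF : ∀ θ ∈ Set.uIcc 0 Real.pi, HasDerivAt
        (fun θ => -((Real.cos θ + ν * Real.sin θ) * Real.exp (-ν * θ)))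
        ((1 + ν ^ 2) * (Real.sin θ * Real.exp (-ν * θ))) θ := by
      intro θ _
      have h1 := (Real.hasDerivAt_cos θ).add ((Real.hasDerivAt_sin θ).const_mul ν)
      refine ((h1.mul ((hasDerivAt_id θ).const_mul (-ν)).exp).neg).congr_deriv ?_
      simp
      ring
    have hi := intervalIntegral.integral_eq_sub_of_hasDerivAt hF
      (Continuous.intervalIntegrable (by fun_prop) _ _)
    rw [intervalIntegral.integral_const_mul] at hi
    simp only [expWeightInt_apply, eval_one, pow_one, one_mul]
    rw [hi]
    simp
    ring
  have h1 := gammaNormSq_add_one (ν := ν) (s := 1 / 2) (Or.inl (by norm_num))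
  rw [show (1 / 2 + 1 : ℝ) = 3 / 2 by norm_num] at h1
  have h3 := gammaNormSq_half ν
  have h2 : 1 + Real.exp (-ν * Real.pi)
      = 2 * Real.cosh (Real.pi * ν / 2) * Real.exp (-(Real.pi * ν / 2)) := by
    rw [Real.cosh_eq, show -ν * Real.pi = -(Real.pi * ν / 2) + -(Real.pi * ν / 2) by ring,
      Real.exp_add]
    have : Real.exp (Real.pi * ν / 2) * Real.exp (-(Real.pi * ν / 2)) = 1 := by
      rw [← Real.exp_add]; simp
    linear_combination -this
  rw [h2] at h
  linear_combination expWeightInt ν 1 1 / 2 * h1 + gammaNormSq ν (1 / 2) / 2 * h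
    + Real.exp (-(Real.pi * ν / 2)) * h3

/-- Closed form of the integral of `sin θ ^ k * exp (-ν θ)` over `[0, π]`. -/
theorem expWeightInt_one_mul_gammaNormSq (ν : ℝ) (k : ℕ) :
    expWeightInt ν k 1 * 2 ^ k * gammaNormSq ν ((k : ℝ) / 2 + 1)
      = Real.pi * Real.exp (-(Real.pi * ν / 2)) * k.factorial := by
  induction k using Nat.twoStepInduction with
  | zero => simpa using expWeightInt_zero_one ν
  | one =>
    have := expWeightInt_one_one ν
    norm_num at this ⊢
    exact this
  | more k h0 _ =>
    have h1 := gammaNormSq_add_one (ν := ν) (s := (k : ℝ) / 2 + 1) (Or.inl (by positivity))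
    have h2 := expWeightInt_one_add_two ν k
    push_cast [Nat.factorial_succ]
    rw [show ((k : ℝ) + 2) / 2 + 1 = (k / 2 + 1) + 1 by ring]
    linear_combination expWeightInt ν (k + 2) 1 * 2 ^ k * h1
      + 2 ^ k * gammaNormSq ν (k / 2 + 1) * h2 + (k + 2) * (k + 1) * h0

/-- Dividing the closed form by its case ν = 0 removes π, k! and 2^k. -/
theorem expWeightInt_one_ratio (ν : ℝ) {k : ℕ} {lam : ℝ} (hk : (k : ℝ) = 2 * lam) :
    expWeightInt ν k 1 * gammaNormSq ν (lam + 1) =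
      Real.exp (-(Real.pi * ν / 2)) * Real.Gamma (lam + 1) ^ 2 * expWeightInt 0 k 1 := by
  have h := expWeightInt_one_mul_gammaNormSq ν k
  have h0 := expWeightInt_one_mul_gammaNormSq 0 k
  rw [gammaNormSq_zero_right] at h0
  rw [show (k : ℝ) / 2 = lam by rw [hk]; ring] at h h0
  simp only [mul_zero, zero_div, neg_zero, Real.exp_zero, mul_one] at h0
  apply mul_left_cancel₀ (pow_ne_zero k (two_ne_zero : (2 : ℝ) ≠ 0))
  linear_combination h - Real.exp (-(Real.pi * ν / 2)) * h0

/-! ### The closed-form coefficients and the inversion formula -/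

/-- The closed form of the Schoenberg coefficients of `exp (-ν θ)`. -/
noncomputable def expCovCoeff (lam ν : ℝ) (n : ℕ) : ℝ :=
  expCovConst ν n * (lam + n) * Real.Gamma lam * Real.Gamma (lam + 1) *
    (gammaNormSq ν (n / 2) / gammaNormSq ν (lam + 1 + n / 2))

theorem expCovConst_add_two (ν : ℝ) (n : ℕ) : expCovConst ν (n + 2) = expCovConst ν n := by
  simp [expCovConst, Nat.even_add]

section

variable {lam ν : ℝ} (hl : 0 < lam) (hν : 0 < ν)
include hl hν

theorem expCovCoeff_nonneg (n : ℕ) : 0 ≤ expCovCoeff lam ν n := by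
  have h1 : 0 ≤ expCovConst ν n := by
    have := Real.pi_pos
    have h2 : 0 ≤ Real.sinh (Real.pi * ν / 2) := Real.sinh_nonneg_iff.2 (by positivity)
    have h3 := (Real.cosh_pos (Real.pi * ν / 2)).le
    unfold expCovConst
    split_ifs <;> positivity
  have h4 := (Real.Gamma_pos_of_pos hl).le
  have h5 := (Real.Gamma_pos_of_pos (show 0 < lam + 1 by positivity)).le
  unfold expCovCoeff gammaNormSq
  positivity

theorem expCovCoeff_add_two (n : ℕ) :
    (lam + n) * ((n + 2 * lam + 2) ^ 2 + ν ^ 2) * expCovCoeff lam ν (n + 2) =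
      (lam + n + 2) * (n ^ 2 + ν ^ 2) * expCovCoeff lam ν n := by
  have h1 := gammaNormSq_add_one (ν := ν) (s := (n : ℝ) / 2) (Or.inr hν.ne')
  have h2 := gammaNormSq_add_one (ν := ν) (s := lam + 1 + (n : ℝ) / 2) (Or.inl (by positivity))
  have p1 := gammaNormSq_pos ν (show 0 < lam + 1 + (n : ℝ) / 2 by positivity)
  have p2 := gammaNormSq_pos ν (show 0 < lam + 1 + (n : ℝ) / 2 + 1 by positivity)
  unfold expCovCoeff
  rw [expCovConst_add_two]
  push_cast
  rw [show ((n : ℝ) + 2) / 2 = n / 2 + 1 by ring,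
    show lam + 1 + ((n : ℝ) / 2 + 1) = lam + 1 + n / 2 + 1 by ring]
  generalize gammaNormSq ν (lam + 1 + n / 2 + 1) = a at *
  generalize gammaNormSq ν (lam + 1 + n / 2) = b at *
  generalize gammaNormSq ν ((n : ℝ) / 2 + 1) = c at *
  generalize gammaNormSq ν ((n : ℝ) / 2) = e at *
  have key : ((n + 2 * lam + 2) ^ 2 + ν ^ 2) * (c / a) = (n ^ 2 + ν ^ 2) * (e / b) := by
    rw [← mul_div_assoc, ← mul_div_assoc, div_eq_div_iff p2.ne' p1.ne']
    linear_combination (-c) * h2 + a * h1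
  linear_combination (expCovConst ν n * (lam + n + 2) * Real.Gamma lam * Real.Gamma (lam + 1))
    * (lam + n) * key

variable {k : ℕ} (hk : (k : ℝ) = 2 * lam)
include hk

/-- Both sides obey the same two-step recurrence, so n = 0 and n = 1 decide. -/
theorem expWeightInt_gegenbauerPoly (n : ℕ) :
    expWeightInt ν k (gegenbauerPoly lam n) =
      expCovCoeff lam ν n * expWeightInt 0 k (gegenbauerPoly lam n ^ 2) := by
  have hG : Real.Gamma (lam + 1) = lam * Real.Gamma lam := Real.Gamma_add_one hl.ne'
  have pG := Real.Gamma_pos_of_pos hl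
  have pI := expWeightInt_one_pos 0 k
  induction n using Nat.twoStepInduction with
  | zero =>
    have h := expWeightInt_one_ratio ν hk
    have h0 := gammaNormSq_zero hν.ne'
    have p := gammaNormSq_pos ν (show 0 < lam + 1 by positivity)
    simp only [gegenbauerPoly, expCovCoeff, expCovConst, Even.zero, if_true, Nat.cast_zero,
      zero_div, add_zero, one_pow]
    have : expWeightInt ν k 1 = Real.exp (-(Real.pi * ν / 2)) * Real.Gamma (lam + 1) ^ 2 *
      expWeightInt 0 k 1 / gammaNormSq ν (lam + 1) := by
      rw [eq_div_iff p.ne', h]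
    rw [this]
    have hpi := Real.pi_pos
    field_simp
    rw [hG]
    linear_combination (-lam * Real.Gamma lam) * h0
  | one =>
    have hc := gammaNormSq_half ν
    have hX := expWeightInt_X ν k
    have p := gammaNormSq_pos ν (show 0 < lam + 1 + 1 / 2 by positivity)
    have hsq := expWeightInt_zero_gegenbauerPoly_sq_succ hk hl 0
    have h1 := expWeightInt_one_mul_gammaNormSq ν (k + 1)
    have h0 := expWeightInt_one_mul_gammaNormSq 0 k
    rw [gammaNormSq_zero_right, show (k : ℝ) / 2 = lam by rw [hk]; ring] at h0
    rw [show ((k + 1 : ℕ) : ℝ) / 2 + 1 = lam + 1 + 1 / 2 by push_cast; rw [hk]; ring] at h1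
    push_cast [Nat.factorial_succ] at h1
    simp only [mul_zero, zero_div, neg_zero, Real.exp_zero, mul_one] at h0
    -- By parts, the integral of X is ν/(k+1) times the weight-(k+1) integral of 1; its closed form
    -- is compared with weight k at ν = 0.
    have h2 : 2 * gammaNormSq ν (lam + 1 + 1 / 2) * expWeightInt ν k X =
        ν * Real.exp (-(Real.pi * ν / 2)) * Real.Gamma (lam + 1) ^ 2 * expWeightInt 0 k 1 := by
      have hne : ((k : ℝ) + 1) * 2 ^ k ≠ 0 := by positivity
      apply mul_left_cancel₀ hne
      linear_combination 2 * 2 ^ k * gammaNormSq ν (lam + 1 + 1 / 2) * hX + ν * h1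
        - ν * ((k : ℝ) + 1) * Real.exp (-(Real.pi * ν / 2)) * h0
    simp only [Nat.cast_zero, zero_add, gegenbauerPoly, one_pow, one_mul] at hsq ⊢
    rw [expWeightInt_C_mul]
    simp only [expCovCoeff, expCovConst, Nat.not_even_one, if_false, Nat.cast_one]
    have hpi := Real.pi_pos
    have hcosh := Real.cosh_pos (Real.pi * ν / 2)
    have e1 : expWeightInt ν k X = ν * Real.exp (-(Real.pi * ν / 2)) * Real.Gamma (lam + 1) ^ 2 *
        expWeightInt 0 k 1 / (2 * gammaNormSq ν (lam + 1 + 1 / 2)) := by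
      rw [eq_div_iff (by positivity), ← h2]
      ring
    have e2 : gammaNormSq ν (1 / 2) = Real.pi / Real.cosh (Real.pi * ν / 2) := by
      rw [eq_div_iff hcosh.ne']
      linear_combination hc
    have e3 : expWeightInt 0 k ((C (2 * lam) * X) ^ 2) =
        lam * (2 * lam) * expWeightInt 0 k 1 / (1 + lam) := by
      rw [eq_div_iff (by positivity), ← hsq]
      ring
    rw [e1, e2, e3, hG]
    have hl' : 1 + lam ≠ 0 := by positivity
    field_simp
    ring
  | more n h0 h1 =>
    have hA := expWeightInt_gegenbauerPoly_add_two hk ν n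
    have hB := expCovCoeff_add_two hl hν n
    have s0 := expWeightInt_zero_gegenbauerPoly_sq_succ hk hl n
    have s1 := expWeightInt_zero_gegenbauerPoly_sq_succ hk hl (n + 1)
    rw [h0] at hA
    push_cast at s1
    rw [show n + 1 + 1 = n + 2 from rfl] at s1
    generalize expWeightInt ν k (gegenbauerPoly lam (n + 2)) = a at *
    generalize expWeightInt 0 k (gegenbauerPoly lam (n + 2) ^ 2) = g2 at *
    generalize expWeightInt 0 k (gegenbauerPoly lam (n + 1) ^ 2) = g1 at *
    generalize expWeightInt 0 k (gegenbauerPoly lam n ^ 2) = g0 at *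
    generalize expCovCoeff lam ν (n + 2) = b2 at *
    generalize expCovCoeff lam ν n = b0 at *
    have s : ((n : ℝ) + 1) * (n + 2) * (n + 2 + lam) * g2 =
        (n + lam) * (n + 2 * lam) * (n + 2 * lam + 1) * g0 := by
      linear_combination ((n : ℝ) + 1) * s1 + (n + 1 + 2 * lam) * s0
    have hne : (lam + n) * (((n : ℝ) + 1) * (n + 2) * ((n + 2 * lam + 2) ^ 2 + ν ^ 2)) ≠ 0 := by
      positivity
    apply mul_left_cancel₀ hne
    have hne2 : (lam + n + 2 : ℝ) ≠ 0 := by positivity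
    apply mul_left_cancel₀ hne2
    linear_combination (lam + n + 2) * (lam + n) * hA
      - ((n : ℝ) + 1) * (n + 2) * g2 * (lam + n + 2) * hB
      - (lam + n + 2) * (n ^ 2 + ν ^ 2) * b0 * s

end

theorem expWeightInt_zero_gegenbauerPoly_sq_pos {k : ℕ} {lam : ℝ} (hk : (k : ℝ) = 2 * lam)
    (hl : 0 < lam) (n : ℕ) :
    0 < expWeightInt 0 k (gegenbauerPoly lam n ^ 2) := by
  induction n with
  | zero => simpa [gegenbauerPoly] using expWeightInt_one_pos 0 k
  | succ n ih =>
    have h := expWeightInt_zero_gegenbauerPoly_sq_succ hk hl n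
    have : 0 < ((n : ℝ) + 1) * (n + 1 + lam) *
        expWeightInt 0 k (gegenbauerPoly lam (n + 1) ^ 2) := by
      rw [h]; positivity
    exact pos_of_mul_pos_right this (by positivity)

/-! ### Summability at the pole -/

theorem expCovCoeff_mul_gegenbauer_one_add_two {lam ν : ℝ} (hl : 0 < lam) (hν : 0 < ν) (n : ℕ) :
    (lam + n) * ((n + 2 * lam + 2) ^ 2 + ν ^ 2) * (n + 1) * (n + 2) *
        (expCovCoeff lam ν (n + 2) * gegenbauer lam (n + 2) 1) =
      (lam + n + 2) * (n ^ 2 + ν ^ 2) * (n + 2 * lam) * (n + 2 * lam + 1) *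
        (expCovCoeff lam ν n * gegenbauer lam n 1) := by
  have h := expCovCoeff_add_two hl hν n
  have g0 := gegenbauer_one_succ lam n
  have g1 := gegenbauer_one_succ lam (n + 1)
  push_cast at g1
  rw [show n + 1 + 1 = n + 2 from rfl] at g1
  have g : ((n : ℝ) + 1) * (n + 2) * gegenbauer lam (n + 2) 1 =
      (n + 2 * lam) * (n + 2 * lam + 1) * gegenbauer lam n 1 := by
    linear_combination ((n : ℝ) + 1) * g1 + (n + 1 + 2 * lam) * g0
  linear_combination ((n : ℝ) + 1) * (n + 2) * gegenbauer lam (n + 2) 1 * h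
    + (lam + n + 2) * (n ^ 2 + ν ^ 2) * expCovCoeff lam ν n * g

theorem eventually_nonneg_quartic (a b c d : ℝ) :
    ∀ᶠ x : ℝ in Filter.atTop, 0 ≤ x ^ 4 + a * x ^ 3 + b * x ^ 2 + c * x + d := by
  filter_upwards [Filter.eventually_ge_atTop (1 + |a| + |b| + |c| + |d|)] with x hx
  have hx1 : 1 ≤ x := by
    linarith [abs_nonneg a, abs_nonneg b, abs_nonneg c, abs_nonneg d]
  have h3 : 0 ≤ x ^ 3 := by positivity
  have h32 : x ^ 2 ≤ x ^ 3 := pow_le_pow_right₀ hx1 (by norm_num)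
  have h31 : x ≤ x ^ 3 := le_self_pow₀ hx1 (by norm_num)
  have h30 : 1 ≤ x ^ 3 := one_le_pow₀ hx1
  have e4 : (1 + |a| + |b| + |c| + |d|) * x ^ 3 ≤ x * x ^ 3 := mul_le_mul_of_nonneg_right hx h3
  have ea : -|a| * x ^ 3 ≤ a * x ^ 3 := mul_le_mul_of_nonneg_right (neg_abs_le a) h3
  have eb : -|b| * x ^ 2 ≤ b * x ^ 2 := mul_le_mul_of_nonneg_right (neg_abs_le b) (by positivity)
  have ec : -|c| * x ≤ c * x := mul_le_mul_of_nonneg_right (neg_abs_le c) (by positivity)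
  have ed := neg_abs_le d
  have fb := mul_le_mul_of_nonneg_left h32 (abs_nonneg b)
  have fc := mul_le_mul_of_nonneg_left h31 (abs_nonneg c)
  have fd := mul_le_mul_of_nonneg_left h30 (abs_nonneg d)
  linarith

/-- A two-step Raabe test: the hypothesis says that n t_n + (n+1) t_{n+1} drops by at least t_n when
n increases by one, so the sums telescope. -/
theorem summable_of_eventually_mul_add_two_le {t : ℕ → ℝ} (ht : ∀ n, 0 ≤ t n)
    (h : ∀ᶠ n : ℕ in Filter.atTop, ((n : ℝ) + 2) * t (n + 2) ≤ (n - 1) * t n) : Summable t := by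
  obtain ⟨N, hN⟩ := Filter.eventually_atTop.1 h
  rw [← summable_nat_add_iff N]
  apply summable_of_sum_range_le (c := N * t N + (N + 1) * t (N + 1)) (fun n => ht _)
  intro m
  have key : ∑ i ∈ Finset.range m, t (i + N) + (((m + N : ℕ) : ℝ) * t (m + N)
      + (((m + N : ℕ) : ℝ) + 1) * t (m + N + 1)) ≤ N * t N + (N + 1) * t (N + 1) := by
    induction m with
    | zero => simp
    | succ m ih =>
      rw [Finset.sum_range_succ, show m + 1 + N = m + N + 1 by ring]
      have h1 := hN (m + N) (by omega)
      push_cast at h1 ih ⊢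
      rw [show m + N + 1 + 1 = m + N + 2 from rfl]
      linarith
  have h1 := ht (m + N)
  have h2 := ht (m + N + 1)
  have : 0 ≤ ((m + N : ℕ) : ℝ) * t (m + N) + (((m + N : ℕ) : ℝ) + 1) * t (m + N + 1) := by
    positivity
  linarith

/-- The two-step ratio is 1 - 4/n + O(n⁻²), eventually below the (n-1)/(n+2) = 1 - 3/n + O(n⁻²)
required by the Raabe test. -/
theorem summable_expCovCoeff_mul_gegenbauer_one {lam ν : ℝ} (hl : 0 < lam) (hν : 0 < ν) :
    Summable fun n => expCovCoeff lam ν n * gegenbauer lam n 1 := by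
  have h0 : ∀ n, 0 ≤ expCovCoeff lam ν n * gegenbauer lam n 1 := fun n =>
    mul_nonneg (expCovCoeff_nonneg hl hν n) (gegenbauer_one_pos hl n).le
  apply summable_of_eventually_mul_add_two_le h0
  have hpoly : ∀ᶠ x : ℝ in Filter.atTop,
      (lam + x + 2) * (x ^ 2 + ν ^ 2) * (x + 2 * lam) * (x + 2 * lam + 1) ≤
        (x - 1) * (lam + x) * ((x + 2 * lam + 2) ^ 2 + ν ^ 2) * (x + 1) := by
    -- With these letters the factors are (x+A)² + ν², x² + Bx + D and x + L. The quintic terms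
    -- cancel, and the difference is a quartic with leading coefficient 1.
    set A := 2 * lam + 2 with hA
    set B := 4 * lam + 1 with hB
    set D := 2 * lam * (2 * lam + 1) with hD
    set L := lam + 2 with hL
    filter_upwards [eventually_nonneg_quartic (A ^ 2 + 2 * A * lam - 1 - (D + L * B))
      (lam * (A ^ 2 + ν ^ 2) - 2 * A - lam - (L * D + ν ^ 2 * (B + L)))
      (-(A ^ 2 + ν ^ 2 + 2 * A * lam) - ν ^ 2 * (D + L * B))
      (-(lam * (A ^ 2 + ν ^ 2)) - ν ^ 2 * (L * D))] with x hx
    rw [hA, hB, hD, hL] at hx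
    linarith
  filter_upwards [tendsto_natCast_atTop_atTop.eventually hpoly] with n hn
  have h := expCovCoeff_mul_gegenbauer_one_add_two hl hν n
  have hpos : 0 < (lam + n) * (((n : ℝ) + 2 * lam + 2) ^ 2 + ν ^ 2) * (n + 1) := by positivity
  apply le_of_mul_le_mul_left _ hpos
  calc _ = (lam + n + 2) * ((n : ℝ) ^ 2 + ν ^ 2) * (n + 2 * lam) * (n + 2 * lam + 1) *
        (expCovCoeff lam ν n * gegenbauer lam n 1) := by linear_combination h
    _ ≤ (n - 1) * (lam + n) * (((n : ℝ) + 2 * lam + 2) ^ 2 + ν ^ 2) * (n + 1) *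
        (expCovCoeff lam ν n * gegenbauer lam n 1) := mul_le_mul_of_nonneg_right hn (h0 n)
    _ = _ := by ring

/-! ### Completeness -/

/-- The span contains 1 and, by the recurrence solved for X G_n, is stable under multiplication by
X. -/
theorem span_gegenbauerPoly_eq_top {lam : ℝ} (hl : 0 < lam) :
    Submodule.span ℝ (Set.range (gegenbauerPoly lam)) = ⊤ := by
  set S := Submodule.span ℝ (Set.range (gegenbauerPoly lam)) with hS
  have hG (n : ℕ) : gegenbauerPoly lam n ∈ S := Submodule.subset_span ⟨n, rfl⟩
  have hXG (n : ℕ) : X * gegenbauerPoly lam n ∈ S := by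
    cases n with
    | zero =>
      have h := S.smul_mem (2 * lam)⁻¹ (hG 1)
      rw [gegenbauerPoly, ← smul_eq_C_mul, smul_smul, inv_mul_cancel₀ (by positivity),
        one_smul] at h
      simpa [gegenbauerPoly] using h
    | succ n =>
      have r := gegenbauerPoly_recurrence lam n
      have h := S.smul_mem (2 * ((n : ℝ) + 1 + lam))⁻¹
        (S.add_mem (S.smul_mem ((n : ℝ) + 2) (hG (n + 2)))
          (S.smul_mem ((n : ℝ) + 2 * lam) (hG n)))
      rw [smul_eq_C_mul ((n : ℝ) + 2), smul_eq_C_mul ((n : ℝ) + 2 * lam), r, sub_add_cancel,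
        ← smul_eq_C_mul, smul_smul, inv_mul_cancel₀ (by positivity), one_smul] at h
      exact h
  have hX : ∀ p ∈ S, X * p ∈ S := by
    intro p hp
    induction hp using Submodule.span_induction with
    | mem x hx =>
      obtain ⟨n, rfl⟩ := hx
      exact hXG n
    | zero => simp
    | add x y _ _ h1 h2 => rw [mul_add]; exact S.add_mem h1 h2
    | smul a x _ h => rw [mul_smul_comm]; exact S.smul_mem a h
  have hXn (n : ℕ) : (X ^ n : ℝ[X]) ∈ S := by
    induction n with
    | zero => exact hG 0
    | succ n ih => rw [pow_succ']; exact hX _ ih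
  rw [eq_top_iff]
  rintro p -
  induction p using Polynomial.induction_on' with
  | add p q hp hq => exact S.add_mem hp hq
  | monomial n a =>
    rw [← C_mul_X_pow_eq_monomial, ← smul_eq_C_mul]
    exact S.smul_mem a (hXn n)

theorem integral_eval_cos_eq_zero {lam : ℝ} (hl : 0 < lam) (k : ℕ) {f : ℝ → ℝ} (hf : Continuous f)
    (h : ∀ n, ∫ θ in (0 : ℝ)..Real.pi,
      (gegenbauerPoly lam n).eval (Real.cos θ) * Real.sin θ ^ k * f θ = 0) (p : ℝ[X]) :
    ∫ θ in (0 : ℝ)..Real.pi, p.eval (Real.cos θ) * Real.sin θ ^ k * f θ = 0 := by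
  have hp : p ∈ Submodule.span ℝ (Set.range (gegenbauerPoly lam)) := by
    rw [span_gegenbauerPoly_eq_top hl]; trivial
  induction hp using Submodule.span_induction with
  | mem x hx =>
    obtain ⟨n, rfl⟩ := hx
    exact h n
  | zero => simp
  | add x y _ _ h1 h2 =>
    simp only [eval_add, add_mul]
    rw [intervalIntegral.integral_add (Continuous.intervalIntegrable (by fun_prop) _ _)
      (Continuous.intervalIntegrable (by fun_prop) _ _), h1, h2, add_zero]
  | smul a x _ h =>
    simp only [eval_smul, smul_eq_mul, mul_assoc] at h ⊢
    rw [intervalIntegral.integral_const_mul, h, mul_zero]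

/-- Completeness of the Gegenbauer polynomials among continuous functions. -/
theorem eq_zero_of_integral_gegenbauerPoly_eq_zero {lam : ℝ} (hl : 0 < lam) (k : ℕ) {f : ℝ → ℝ}
    (hf : Continuous f)
    (h : ∀ n, ∫ θ in (0 : ℝ)..Real.pi,
      (gegenbauerPoly lam n).eval (Real.cos θ) * Real.sin θ ^ k * f θ = 0) :
    ∀ θ ∈ Set.Icc 0 Real.pi, f θ = 0 := by
  have hsin : ∀ θ ∈ Set.Icc 0 Real.pi, 0 ≤ Real.sin θ ^ k := fun θ hθ =>
    pow_nonneg (Real.sin_nonneg_of_mem_Icc hθ) k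
  set M := ∫ θ in (0 : ℝ)..Real.pi, Real.sin θ ^ k * |f θ| with hM
  set I := ∫ θ in (0 : ℝ)..Real.pi, f θ ^ 2 * Real.sin θ ^ k with hI
  have hM0 : 0 ≤ M := intervalIntegral.integral_nonneg Real.pi_pos.le fun θ hθ =>
    mul_nonneg (hsin θ hθ) (abs_nonneg _)
  -- By Weierstrass, f is within ε of some p(cos θ), and p(cos θ) is orthogonal to f.
  have hle : ∀ ε > 0, I ≤ ε * M := by
    intro ε hε
    obtain ⟨p, hp⟩ := exists_polynomial_near_of_continuousOn (-1) 1 (fun x => f (Real.arccos x))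
      (hf.comp Real.continuous_arccos).continuousOn ε hε
    have hz := integral_eval_cos_eq_zero hl k hf h p
    calc I = I - ∫ θ in (0 : ℝ)..Real.pi, p.eval (Real.cos θ) * Real.sin θ ^ k * f θ := by
          rw [hz, sub_zero]
      _ = ∫ θ in (0 : ℝ)..Real.pi, (f θ ^ 2 * Real.sin θ ^ k
          - p.eval (Real.cos θ) * Real.sin θ ^ k * f θ) :=
          (intervalIntegral.integral_sub (Continuous.intervalIntegrable (by fun_prop) _ _)
            (Continuous.intervalIntegrable (by fun_prop) _ _)).symm
      _ ≤ ∫ θ in (0 : ℝ)..Real.pi, ε * (Real.sin θ ^ k * |f θ|) := by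
          apply intervalIntegral.integral_mono_on Real.pi_pos.le
            (Continuous.intervalIntegrable (by fun_prop) _ _)
            (Continuous.intervalIntegrable (by fun_prop) _ _)
          intro θ hθ
          have h1 := hp (Real.cos θ) (Real.cos_mem_Icc θ)
          rw [Real.arccos_cos hθ.1 hθ.2, abs_sub_comm] at h1
          calc f θ ^ 2 * Real.sin θ ^ k - p.eval (Real.cos θ) * Real.sin θ ^ k * f θ
              = Real.sin θ ^ k * ((f θ - p.eval (Real.cos θ)) * f θ) := by ring
            _ ≤ Real.sin θ ^ k * (ε * |f θ|) := by
                apply mul_le_mul_of_nonneg_left _ (hsin θ hθ)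
                refine (le_abs_self _).trans ?_
                rw [abs_mul]
                exact mul_le_mul_of_nonneg_right h1.le (abs_nonneg _)
            _ = ε * (Real.sin θ ^ k * |f θ|) := by ring
      _ = ε * M := by rw [intervalIntegral.integral_const_mul]
  have hI0 : I ≤ 0 := by
    apply le_of_forall_pos_le_add
    intro ε hε
    have h1 := hle (ε / (M + 1)) (by positivity)
    have h2 : ε / (M + 1) * M ≤ ε := by
      rw [div_mul_eq_mul_div, div_le_iff₀ (by positivity)]
      nlinarith
    linarith
  have hIoo : Set.EqOn f 0 (Set.Ioo 0 Real.pi) := by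
    intro θ hθ
    by_contra hne
    have hpos : 0 < I := by
      apply intervalIntegral.integral_pos Real.pi_pos (by fun_prop)
      · intro x hx
        exact mul_nonneg (sq_nonneg _) (hsin x ⟨hx.1.le, hx.2⟩)
      · refine ⟨θ, ⟨hθ.1.le, hθ.2.le⟩, ?_⟩
        have := Real.sin_pos_of_mem_Ioo hθ
        have hne' : f θ ≠ 0 := hne
        positivity
    linarith
  -- The weight may vanish at 0 and π, so the endpoints are reached by continuity.
  have hcl := hIoo.closure hf continuous_zero
  rw [closure_Ioo Real.pi_pos.ne] at hcl
  exact fun θ hθ => hcl hθ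

/-! ### Termwise integration, expansion and conclusion -/

theorem norm_mul_gegenbauer_cos_le {lam : ℝ} (hl : 0 < lam) {b : ℕ → ℝ} (hb : ∀ n, 0 ≤ b n)
    (n : ℕ) (θ : ℝ) : ‖b n * gegenbauer lam n (Real.cos θ)‖ ≤ b n * gegenbauer lam n 1 := by
  rw [norm_mul, Real.norm_of_nonneg (hb n)]
  exact mul_le_mul_of_nonneg_left (abs_gegenbauer_le hl n (Real.cos_mem_Icc θ)) (hb n)

/-- Dominated convergence with the summable constants G_m(1) b_n G_n(1) allows termwise integration;
orthogonality leaves the term n = m. Serves both uniqueness and the identification of the sum. -/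
theorem integral_gegenbauerPoly_mul_of_hasSum {k : ℕ} {lam : ℝ} (hk : (k : ℝ) = 2 * lam)
    (hl : 0 < lam) {b : ℕ → ℝ} (hb : ∀ n, 0 ≤ b n)
    (hs : Summable fun n => b n * gegenbauer lam n 1) {f : ℝ → ℝ}
    (hf : ∀ θ ∈ Set.Icc 0 Real.pi, HasSum (fun n => b n * gegenbauer lam n (Real.cos θ)) (f θ))
    (m : ℕ) :
    ∫ θ in (0 : ℝ)..Real.pi, (gegenbauerPoly lam m).eval (Real.cos θ) * Real.sin θ ^ k * f θ =
      b m * expWeightInt 0 k (gegenbauerPoly lam m ^ 2) := by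
  have hterm : ∀ n, ∫ θ in (0 : ℝ)..Real.pi,
      (gegenbauerPoly lam m).eval (Real.cos θ) * Real.sin θ ^ k *
        (b n * gegenbauer lam n (Real.cos θ)) =
      b n * expWeightInt 0 k (gegenbauerPoly lam m * gegenbauerPoly lam n) := by
    intro n
    rw [expWeightInt_apply, ← intervalIntegral.integral_const_mul]
    congr 1
    ext θ
    simp only [← eval_gegenbauerPoly, eval_mul, neg_zero, zero_mul, Real.exp_zero]
    ring
  have hsum : HasSum (fun n => ∫ θ in (0 : ℝ)..Real.pi,
      (gegenbauerPoly lam m).eval (Real.cos θ) * Real.sin θ ^ k *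
        (b n * gegenbauer lam n (Real.cos θ)))
      (∫ θ in (0 : ℝ)..Real.pi,
        (gegenbauerPoly lam m).eval (Real.cos θ) * Real.sin θ ^ k * f θ) := by
    apply intervalIntegral.hasSum_integral_of_dominated_convergence
      (fun n _ => gegenbauer lam m 1 * (b n * gegenbauer lam n 1))
    · intro n
      simp only [← eval_gegenbauerPoly]
      exact Continuous.aestronglyMeasurable (by fun_prop)
    · intro n
      filter_upwards with θ _
      rw [norm_mul]
      apply mul_le_mul _ (norm_mul_gegenbauer_cos_le hl hb n θ) (norm_nonneg _)
        (gegenbauer_one_pos hl m).le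
      rw [norm_mul, eval_gegenbauerPoly, norm_pow]
      calc _ ≤ gegenbauer lam m 1 * 1 := by
            apply mul_le_mul (abs_gegenbauer_le hl m (Real.cos_mem_Icc θ)) _ (by positivity)
              (gegenbauer_one_pos hl m).le
            exact pow_le_one₀ (norm_nonneg _) (Real.abs_sin_le_one θ)
        _ = _ := mul_one _
    · filter_upwards with θ _
      exact hs.mul_left _
    · exact intervalIntegrable_const
    · filter_upwards with θ hθ
      rw [Set.uIoc_of_le Real.pi_pos.le] at hθ
      exact (hf θ ⟨hθ.1.le, hθ.2⟩).mul_left _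
  simp only [hterm] at hsum
  rw [pow_two]
  refine hsum.unique (hasSum_single m fun n hn => ?_)
  rw [expWeightInt_zero_gegenbauerPoly_mul hk hl hn.symm, mul_zero]

theorem hasSum_expCovCoeff_mul_gegenbauer {k : ℕ} {lam ν : ℝ} (hk : (k : ℝ) = 2 * lam)
    (hl : 0 < lam) (hν : 0 < ν) {θ : ℝ} (hθ : θ ∈ Set.Icc 0 Real.pi) :
    HasSum (fun n => expCovCoeff lam ν n * gegenbauer lam n (Real.cos θ))
      (Real.exp (-ν * θ)) := by
  have hb := expCovCoeff_nonneg hl hν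
  have hs := summable_expCovCoeff_mul_gegenbauer_one hl hν
  set S : ℝ → ℝ := fun t => ∑' n, expCovCoeff lam ν n * gegenbauer lam n (Real.cos t) with hS
  have hSsum (t : ℝ) : HasSum (fun n => expCovCoeff lam ν n * gegenbauer lam n (Real.cos t))
      (S t) :=
    (hs.of_norm_bounded fun n => norm_mul_gegenbauer_cos_le hl hb n t).hasSum
  have hScont : Continuous S := by
    refine continuous_tsum (fun n => ?_) hs fun n t => norm_mul_gegenbauer_cos_le hl hb n t
    simp only [← eval_gegenbauerPoly]
    fun_prop
  -- The sum and the exponential have equal moments against every G_n.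
  have hzero := eq_zero_of_integral_gegenbauerPoly_eq_zero hl k
    (f := fun t => S t - Real.exp (-ν * t)) (by fun_prop) (fun n => by
      simp only [mul_sub]
      rw [intervalIntegral.integral_sub (Continuous.intervalIntegrable (by fun_prop) _ _)
        (Continuous.intervalIntegrable (by fun_prop) _ _),
        integral_gegenbauerPoly_mul_of_hasSum hk hl hb hs (fun t _ => hSsum t), sub_eq_zero,
        ← expWeightInt_gegenbauerPoly hl hν hk, expWeightInt_apply]) θ hθ
  rw [← sub_eq_zero.1 hzero]
  exact hSsum θ

theorem mainTheorem5 (d : ℕ) (hd : 2 ≤ d) (ν : ℝ) (hν : 0 < ν)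
    (lam : ℝ) (hlam : lam = ((d : ℝ) - 1) / 2)
    (B : ℕ → ℝ)
    (hB : ∀ n : ℕ, B n =
      expCovConst ν n * (lam + (n : ℝ)) * Real.Gamma lam * Real.Gamma (lam + 1) *
        (‖Complex.Gamma (((n : ℂ) + Complex.I * (ν : ℂ)) / 2)‖ ^ 2 /
          ‖Complex.Gamma ((lam : ℂ) + 1 + ((n : ℂ) + Complex.I * (ν : ℂ)) / 2)‖ ^ 2)) :
    (∀ b : ℕ → ℝ,
      IsSchoenbergSequence d (fun θ => Real.exp (-ν * θ)) b ↔ ∀ n : ℕ, b n = B n) ∧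
    (∀ n : ℕ, schoenbergCoeff d (fun θ => Real.exp (-ν * θ)) n = B n) := by
  subst hlam
  set lam : ℝ := ((d : ℝ) - 1) / 2 with hlam
  have hd' : (2 : ℝ) ≤ d := by exact_mod_cast hd
  have hl : 0 < lam := by rw [hlam]; linarith
  have hk : ((d - 1 : ℕ) : ℝ) = 2 * lam := by
    rw [Nat.cast_sub (by omega), hlam]
    push_cast
    ring
  have hBc (n : ℕ) : B n = expCovCoeff lam ν n := by
    have e1 : ((n : ℂ) + Complex.I * ν) / 2 = ((n / 2 : ℝ) : ℂ) + Complex.I * ν / 2 := by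
      push_cast; ring
    have e2 : (lam : ℂ) + 1 + ((n : ℂ) + Complex.I * ν) / 2
        = ((lam + 1 + n / 2 : ℝ) : ℂ) + Complex.I * ν / 2 := by
      push_cast; ring
    rw [hB n, e2, e1]
    rfl
  have hpos := expWeightInt_zero_gegenbauerPoly_sq_pos hk hl
  have hA := expWeightInt_gegenbauerPoly hl hν hk
  refine ⟨fun b => ⟨fun ⟨hb, hs, hf⟩ n => ?_, fun h => ?_⟩, fun n => ?_⟩
  -- Uniqueness: b_n h_n = A_n = B_n h_n, with h_n > 0.
  · have h := integral_gegenbauerPoly_mul_of_hasSum hk hl hb hs hf n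
    rw [← expWeightInt_apply, hA n] at h
    rw [hBc n]
    exact (mul_right_cancel₀ (hpos n).ne' h).symm
  · obtain rfl : b = expCovCoeff lam ν := funext fun n => (h n).trans (hBc n)
    exact ⟨expCovCoeff_nonneg hl hν, summable_expCovCoeff_mul_gegenbauer_one hl hν,
      fun θ hθ => hasSum_expCovCoeff_mul_gegenbauer hk hl hν hθ⟩
  · have hn : gegenbauerNormSq d n = expWeightInt 0 (d - 1) (gegenbauerPoly lam n ^ 2) := by
      simp only [gegenbauerNormSq, expWeightInt_apply, eval_pow, eval_gegenbauerPoly, neg_zero,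
        zero_mul, Real.exp_zero, mul_one, ← hlam]
    have hi := hA n
    simp only [expWeightInt_apply ν, eval_gegenbauerPoly] at hi
    rw [schoenbergCoeff, hn, ← hlam, hi, hBc n, one_div, mul_comm, mul_assoc,
      mul_inv_cancel₀ (hpos n).ne', mul_one]
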